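/- Let $Z$ be a vector of $N$ real polynomials in $x\in\mathbb{R}^n$ with $Z(0)=0$ and let $W$ be an $M\times m$ matrix of real polynomials in $x$ (for instance, regressors of monomials). Let $\tilde{\mathbf A}\in\mathbb{R}^{(N+M)\times(N+M)}$ be symmetric with $\tilde{\mathbf A}\succ 0$, let $\tilde{\mathbf Q}\in\mathbb{R}^{n\times n}$ be symmetric with $\tilde{\mathbf Q}\succeq 0$, let $\tilde Z_{\mathrm c}\in\mathbb{R}^{(N+M)\times n}$, and let $$\tilde{\mathcal C}=\big\{(A,B)\in\mathbb{R}^{n\times N}\times\mathbb{R}^{n\times M}:\ [A\ \ B]=\mathsf{Z}^\top,\ (\mathsf{Z}-\tilde Z_{\mathrm c})^\top\tilde{\mathbf A}(\mathsf{Z}-\tilde Z_{\mathrm c})\preceq\tilde{\mathbf Q}\big\}.$$ Let $\ell_1,\ell_2$ be positive definite polynomials on $\mathbb{R}^n$ (zero at zero and positive elsewhere) with $\ell_1(x)\to+\infty$ as $|x|\to+\infty$, and let $\epsilon_\lambda>0$. For polynomials $V:\mathbb{R}^n\to\mathbb{R}$, $k:\mathbb{R}^n\to\mathbb{R}^m$,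 $\lambda:\mathbb{R}^n\to\mathbb{R}$ let $$\Psi=\begin{bmatrix}\ell_2+\frac{\partial V}{\partial x}\tilde Z_{\mathrm c}^\top\begin{bmatrix}Z\\ Wk\end{bmatrix}&\star&\star\\ \tilde{\mathbf A}^{-1/2}\begin{bmatrix}Z\\ Wk\end{bmatrix}&-\lambda I&\star\\ \lambda\tilde{\mathbf Q}^{1/2}\frac{\partial V}{\partial x}^\top&0&-4\lambda I\end{bmatrix},$$ a symmetric matrix polynomial ($\star$ stands for the transpose of the block opposite to it across the diagonal, and $^{1/2}$ for the positive semidefinite square root). Suppose that $V(0)=0$, $k(0)=0$, that $V-\ell_1$ and $\lambda-\epsilon_\lambda$ are sums of squares of polynomials, and that $-\Psi$ is a sum-of-squares matrix polynomial, i.e. $-\Psi=\sum_i F_i^\top F_i$ for finitely many square matrix polynomials $F_i$. Then 1. for each $x\in\mathbb{R}^n$: $V(x)-\ell_1(x)\ge 0$, $\Psi(x)\preceq 0$ and $\lambda(x)>0$; 2. for all $(A,B)\in\tilde{\mathcal C}$, the origin of $\dot x=AZ(x)+BW(x)k(x)$ is globally asymptotically stable: it is an equilibrium, solutions from every initial state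 exist for all $t\ge 0$, the origin is Lyapunov stable, and every solution converges to it as $t\to+\infty$. -/

import Mathlib

/-! ### Sums of squares and polynomial positivity -/

/-- A square matrix polynomial is a sum of squares if it is `∑ᵢ Fᵢᵀ Fᵢ` for finitely many
matrix polynomials `Fᵢ` of the same size. (For scalar polynomials Mathlib's `IsSumSq` is used.) -/
def IsSOSMatrix {n : ℕ} {ι : Type*} [Fintype ι]
    (P : Matrix ι ι (MvPolynomial (Fin n) ℝ)) : Prop :=
  ∃ (r : ℕ) (F : Fin r → Matrix ι ι (MvPolynomial (Fin n) ℝ)),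
    P = ∑ i, (F i).transpose * F i

/-- A polynomial is positive definite if it is zero at zero and positive elsewhere. -/
def PolyPosDef {n : ℕ} (p : MvPolynomial (Fin n) ℝ) : Prop :=
  MvPolynomial.eval 0 p = 0 ∧ ∀ x : Fin n → ℝ, x ≠ 0 → 0 < MvPolynomial.eval x p

/-- `p` is radially unbounded: `p(x) → +∞` as `|x| → +∞`. -/
def RadiallyUnbounded {n : ℕ} (p : MvPolynomial (Fin n) ℝ) : Prop :=
  Filter.Tendsto (fun x : EuclideanSpace ℝ (Fin n) => MvPolynomial.eval (fun i => x i) p)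
    (Filter.comap norm Filter.atTop) Filter.atTop

/-! ### Positive semidefinite square root -/

section SquareRoot

open scoped MatrixOrder

/-- The positive semidefinite square root `S^{1/2}` of a positive semidefinite matrix `S`. -/
noncomputable def psdSqrt {ι : Type*} [Fintype ι] [DecidableEq ι]
    (S : Matrix ι ι ℝ) : Matrix ι ι ℝ :=
  CFC.sqrt S

/-- For positive semidefinite `S`, `psdSqrt S` is the unique positive semidefinite matrix whose
square is `S`. -/
theorem psdSqrt_eq_iff {ι : Type*} [Fintype ι] [DecidableEq ι]
    {S R : Matrix ι ι ℝ} (hS : S.PosSemidef) :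
    psdSqrt S = R ↔ R.PosSemidef ∧ R * R = S := by
  constructor
  · rintro rfl
    exact ⟨Matrix.nonneg_iff_posSemidef.mp (CFC.sqrt_nonneg S),
      CFC.sqrt_mul_sqrt_self S hS.nonneg⟩
  · rintro ⟨hR, rfl⟩
    exact CFC.sqrt_unique rfl hR.nonneg

end SquareRoot

/-! ### The uncertainty set -/

/-- The matrix ellipsoid `{ (A, B) : [A B] = Zᵀ, (Z - Zc)ᵀ 𝐀 (Z - Zc) ⪯ 𝐐 }`. -/
def matrixEllipsoid {n N M : ℕ} (bA : Matrix (Fin N ⊕ Fin M) (Fin N ⊕ Fin M) ℝ)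
    (Zc : Matrix (Fin N ⊕ Fin M) (Fin n) ℝ) (bQ : Matrix (Fin n) (Fin n) ℝ) :
    Set (Matrix (Fin n) (Fin N) ℝ × Matrix (Fin n) (Fin M) ℝ) :=
  {AB | ∃ Z : Matrix (Fin N ⊕ Fin M) (Fin n) ℝ,
    Matrix.fromCols AB.1 AB.2 = Z.transpose ∧
      (bQ - (Z - Zc).transpose * bA * (Z - Zc)).PosSemidef}

/-! ### The matrix polynomial of the decrease condition -/

section Decrease

open scoped Matrix

/-- The stacked vector `[Z; W k]` of polynomials. -/
noncomputable def stackedRegressor {n m N M : ℕ} (Z : Fin N → MvPolynomial (Fin n) ℝ)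
    (W : Matrix (Fin M) (Fin m) (MvPolynomial (Fin n) ℝ)) (k : Fin m → MvPolynomial (Fin n) ℝ) :
    Fin N ⊕ Fin M → MvPolynomial (Fin n) ℝ :=
  Sum.elim Z (W *ᵥ k)

/-- The gradient `∂V/∂x` of a polynomial, as a vector of polynomials. -/
noncomputable def polyGrad {n : ℕ} (V : MvPolynomial (Fin n) ℝ) :
    Fin n → MvPolynomial (Fin n) ℝ :=
  fun i => MvPolynomial.pderiv i V

/-- The symmetric matrix polynomial (of size `1 + (N + M) + n`)
```
[ ℓ₂ + (∂V/∂x) Zcᵀ [Z; W k]        ⋆        ⋆    ]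
[ 𝐀^{-1/2} [Z; W k]               -λ I      ⋆    ]
[ λ 𝐐^{1/2} (∂V/∂x)ᵀ               0      -4 λ I ]
```
where the vectors in the first column are `col₂`, `col₃` below. -/
noncomputable def decreaseMatrix {n m N M : ℕ} (Z : Fin N → MvPolynomial (Fin n) ℝ)
    (W : Matrix (Fin M) (Fin m) (MvPolynomial (Fin n) ℝ))
    (bA : Matrix (Fin N ⊕ Fin M) (Fin N ⊕ Fin M) ℝ)
    (Zc : Matrix (Fin N ⊕ Fin M) (Fin n) ℝ) (bQ : Matrix (Fin n) (Fin n) ℝ)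
    (l₂ V lam : MvPolynomial (Fin n) ℝ) (k : Fin m → MvPolynomial (Fin n) ℝ) :
    Matrix ((Unit ⊕ (Fin N ⊕ Fin M)) ⊕ Fin n) ((Unit ⊕ (Fin N ⊕ Fin M)) ⊕ Fin n)
      (MvPolynomial (Fin n) ℝ) :=
  let col₂ : Fin N ⊕ Fin M → MvPolynomial (Fin n) ℝ :=
    (psdSqrt bA)⁻¹.map MvPolynomial.C *ᵥ stackedRegressor Z W k
  let col₃ : Fin n → MvPolynomial (Fin n) ℝ :=
    lam • ((psdSqrt bQ).map MvPolynomial.C *ᵥ polyGrad V)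
  Matrix.fromBlocks
    (Matrix.fromBlocks
      (Matrix.of fun _ _ =>
        l₂ + polyGrad V ⬝ᵥ (Zcᵀ.map MvPolynomial.C *ᵥ stackedRegressor Z W k))
      (Matrix.replicateRow Unit col₂)
      (Matrix.replicateCol Unit col₂)
      (-(lam • (1 : Matrix (Fin N ⊕ Fin M) (Fin N ⊕ Fin M) (MvPolynomial (Fin n) ℝ)))))
    (Matrix.fromRows (Matrix.replicateRow Unit col₃) 0)
    (Matrix.fromCols (Matrix.replicateCol Unit col₃) 0)
    (-((4 * lam) • (1 : Matrix (Fin n) (Fin n) (MvPolynomial (Fin n) ℝ))))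

/-- The closed-loop vector field `f_{A,B}(x) = A Z(x) + B W(x) k(x)` on `ℝⁿ`. -/
noncomputable def closedLoop {n m N M : ℕ} (Z : Fin N → MvPolynomial (Fin n) ℝ)
    (W : Matrix (Fin M) (Fin m) (MvPolynomial (Fin n) ℝ)) (k : Fin m → MvPolynomial (Fin n) ℝ)
    (A : Matrix (Fin n) (Fin N) ℝ) (B : Matrix (Fin n) (Fin M) ℝ)
    (x : EuclideanSpace ℝ (Fin n)) : EuclideanSpace ℝ (Fin n) :=
  WithLp.toLp 2
    (A *ᵥ (fun i => MvPolynomial.eval (fun j => x j) (Z i)) +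
      B *ᵥ (W.map (MvPolynomial.eval fun j => x j) *ᵥ
        fun i => MvPolynomial.eval (fun j => x j) (k i)))

end Decrease

/-! ### Global asymptotic stability -/

/-- `φ` is a solution of `ẋ = f(x)` on `[0, ∞)`. -/
def IsForwardSolution {E : Type*} [NormedAddCommGroup E] [NormedSpace ℝ E]
    (f : E → E) (φ : ℝ → E) : Prop :=
  ∀ t : ℝ, 0 ≤ t → HasDerivWithinAt φ (f (φ t)) (Set.Ici 0) t

/-- The origin of `ẋ = f(x)`, `f` locally Lipschitz, is globally asymptotically stable: it is an
equilibrium, from every initial state there is a solution defined for all `t ≥ 0` (no finite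
escape time; it is unique by the Lipschitz property), the origin is Lyapunov stable, and every
solution converges to it. -/
structure GloballyAsymptoticallyStable {E : Type*} [NormedAddCommGroup E] [NormedSpace ℝ E]
    (f : E → E) : Prop where
  equilibrium : f 0 = 0
  forward_complete : ∀ x₀ : E, ∃ φ : ℝ → E, φ 0 = x₀ ∧ IsForwardSolution f φ
  stable : ∀ ε : ℝ, 0 < ε → ∃ δ : ℝ, 0 < δ ∧ ∀ φ : ℝ → E, IsForwardSolution f φ →
    ‖φ 0‖ < δ → ∀ t : ℝ, 0 ≤ t → ‖φ t‖ < ε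
  attractive : ∀ φ : ℝ → E, IsForwardSolution f φ → Filter.Tendsto φ Filter.atTop (nhds 0)

/-! Sums of squares are pointwise nonnegative, which gives the first claim. For `(A, B)` in the
ellipsoid, with `Yᵀ = [A B]`, `D = Y - Zc`, `g = ∂V/∂x` and `q = [Z; W k]`, the derivative of `V`
along the flow is `g ⬝ Zcᵀ q + g ⬝ Dᵀ q`. Testing `-Ψ(x) ⪰ 0` on one vector depending on `D` and `g`
bounds the uncertain term and gives `V' ≤ -l₂` (`dotProduct_le_of_posSemidef_fromBlocks`). Since `V
≥ l₁`, `V` is a radially unbounded strict Lyapunov function, and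
`globallyAsymptoticallyStable_of_lyapunov` concludes; completeness there comes from cutting the
field off outside a sublevel set. -/

/-! ### Global solutions and Lyapunov's theorem. -/

theorem LipschitzWith.exists_hasDerivWithinAt_Icc {E : Type*} [NormedAddCommGroup E]
    [NormedSpace ℝ E] [CompleteSpace E] {f : E → E} {K : NNReal} (hf : LipschitzWith K f)
    {C : NNReal} (hC : ∀ x, ‖f x‖ ≤ C) (x₀ : E) {T : ℝ} (hT : 0 ≤ T) :
    ∃ φ : ℝ → E, φ 0 = x₀ ∧
      ∀ t ∈ Set.Icc 0 T, HasDerivWithinAt φ (f (φ t)) (Set.Icc 0 T) t := by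
  -- At speed at most `C` no curve leaves the ball of radius `C * T` by time `T`, so the interval
  -- need not be short.
  have h : IsPicardLindelof (fun _ => f) (tmin := 0) (tmax := T) ⟨0, le_refl 0, hT⟩ x₀
      (C * T.toNNReal) 0 C K :=
    { lipschitzOnWith := fun _ _ => hf.lipschitzOnWith
      continuousOn := fun _ _ => continuousOn_const
      norm_le := fun _ _ x _ => hC x
      mul_max_le := by simp [max_eq_left hT, Real.coe_toNNReal T hT] }
  exact h.exists_eq_forall_mem_Icc_hasDerivWithinAt₀

/-- A bounded, globally Lipschitz vector field has a forward solution from every point. -/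
theorem LipschitzWith.exists_isForwardSolution {E : Type*} [NormedAddCommGroup E]
    [NormedSpace ℝ E] [CompleteSpace E] {f : E → E} {K : NNReal} (hf : LipschitzWith K f)
    {C : NNReal} (hC : ∀ x, ‖f x‖ ≤ C) (x₀ : E) :
    ∃ φ : ℝ → E, φ 0 = x₀ ∧ IsForwardSolution f φ := by
  have hex := fun N : ℕ => hf.exists_hasDerivWithinAt_Icc hC x₀ (Nat.cast_nonneg (α := ℝ) N)
  choose ψ hψ0 hψ using hex
  have hagree : ∀ {i j : ℕ}, i ≤ j → Set.EqOn (ψ i) (ψ j) (Set.Icc 0 i) := by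
    intro i j hij
    have hij' : (i : ℝ) ≤ j := by exact_mod_cast hij
    have hright : ∀ {l : ℕ}, i ≤ l → ∀ t ∈ Set.Ico (0 : ℝ) i,
        HasDerivWithinAt (ψ l) (f (ψ l t)) (Set.Ici t) t := by
      intro l hl t ht
      have hl' : (i : ℝ) ≤ l := by exact_mod_cast hl
      refine (hψ l t ⟨ht.1, ht.2.le.trans hl'⟩).mono_of_mem_nhdsWithin ?_
      filter_upwards [Icc_mem_nhdsGE (ht.2.trans_le hl')] with s hs
      exact ⟨ht.1.trans hs.1, hs.2⟩
    refine ODE_solution_unique (v := fun _ => f) (fun _ => hf)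
      (fun t ht => (hψ i t ht).continuousWithinAt) (hright le_rfl)
      (fun t ht => ((hψ j t ⟨ht.1, ht.2.trans hij'⟩).continuousWithinAt.mono
        (Set.Icc_subset_Icc_right hij'))) (hright hij) (by rw [hψ0, hψ0])
  -- The `+ 1` puts `t` strictly before the right endpoint, so derivatives within `Icc` become
  -- derivatives within `Ici 0`.
  refine ⟨fun t => ψ (⌈t⌉₊ + 1) t, by simp [hψ0], fun t ht => ?_⟩
  have hlt : t < ((⌈t⌉₊ + 1 : ℕ) : ℝ) := by
    push_cast
    linarith [Nat.le_ceil t]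
  have hd : HasDerivWithinAt (ψ (⌈t⌉₊ + 1)) (f (ψ (⌈t⌉₊ + 1) t)) (Set.Ici 0) t := by
    refine (hψ _ t ⟨ht, hlt.le⟩).mono_of_mem_nhdsWithin ?_
    filter_upwards [self_mem_nhdsWithin, mem_nhdsWithin_of_mem_nhds (Iio_mem_nhds hlt)]
      with s hs hs'
    exact ⟨hs, le_of_lt hs'⟩
  refine hd.congr_of_eventuallyEq ?_ rfl
  filter_upwards [self_mem_nhdsWithin, mem_nhdsWithin_of_mem_nhds (Iio_mem_nhds hlt)]
    with s hs hs'
  have hs1 : s ≤ ((⌈s⌉₊ + 1 : ℕ) : ℝ) := by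
    push_cast
    linarith [Nat.le_ceil s]
  rcases le_total (⌈s⌉₊ + 1) (⌈t⌉₊ + 1) with h | h
  · exact hagree h ⟨hs, hs1⟩
  · exact (hagree h ⟨hs, le_of_lt hs'⟩).symm

/-- A `C¹` function that decreases at rate `c` along the vector field at the points of a forward
solution decreases at rate `c` along this solution. -/
theorem IsForwardSolution.le_sub_mul {E : Type*} [NormedAddCommGroup E] [NormedSpace ℝ E]
    {f : E → E} {φ : ℝ → E} (hφ : IsForwardSolution f φ) {V : E → ℝ} {V' : E → E →L[ℝ] ℝ}
    (hV : ∀ x, HasFDerivAt V (V' x) x) {c : ℝ}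
    (hc : ∀ t, 0 ≤ t → V' (φ t) (f (φ t)) ≤ -c) {t : ℝ} (ht : 0 ≤ t) :
    V (φ t) ≤ V (φ 0) - c * t := by
  have hd : ∀ s, 0 ≤ s →
      HasDerivWithinAt (fun s => V (φ s)) (V' (φ s) (f (φ s))) (Set.Ici 0) s :=
    fun s hs => (hV (φ s)).comp_hasDerivWithinAt s (hφ s hs)
  refine image_le_of_deriv_right_le_deriv_boundary (f := fun s => V (φ s)) (a := 0) (b := t)
    (B := fun s => V (φ 0) - c * s) (B' := fun _ => -c)
    (fun s hs => (hd s hs.1).continuousWithinAt.mono Set.Icc_subset_Ici_self)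
    (fun s hs => (hd s hs.1).mono (Set.Ici_subset_Ici.2 hs.1)) (by simp) (by fun_prop)
    (fun s _ => ?_) (fun s hs => hc s hs.1) ⟨ht, le_rfl⟩
  simpa using (((hasDerivAt_id s).const_mul c).const_sub (V (φ 0))).hasDerivWithinAt

/-- Bounded sublevel sets and positivity away from the origin: small values are attained only near
the origin. -/
theorem exists_pos_forall_lt_imp_norm_lt {E : Type*} [NormedAddCommGroup E] [ProperSpace E]
    {p : E → ℝ} (hp : Continuous p) (hpos : ∀ x, x ≠ 0 → 0 < p x)
    (hinf : Filter.Tendsto p (Filter.cocompact E) Filter.atTop) {ε : ℝ} (hε : 0 < ε) :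
    ∃ c, 0 < c ∧ ∀ x, p x < c → ‖x‖ < ε := by
  have hclosed : IsClosed {x : E | ε ≤ ‖x‖} := isClosed_le continuous_const continuous_norm
  rcases Set.eq_empty_or_nonempty {x : E | ε ≤ ‖x‖} with he | ⟨y, hy⟩
  · refine ⟨1, one_pos, fun x _ => ?_⟩
    by_contra! h
    exact (Set.eq_empty_iff_forall_notMem.1 he x) h
  -- Coercivity replaces compactness: `p` attains its minimum on this closed set, and that minimum
  -- serves as `c`.
  · obtain ⟨z, hz, hmin⟩ := hp.continuousOn.exists_isMinOn' hclosed hy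
      (Filter.Eventually.filter_mono inf_le_left (hinf.eventually_ge_atTop (p y)))
    have hz0 : z ≠ 0 := norm_pos_iff.1 (hε.trans_le hz)
    refine ⟨p z, hpos z hz0, fun x hx => ?_⟩
    by_contra! h
    exact absurd (hmin h) (not_le.2 hx)

/-- **Lyapunov's theorem** for global asymptotic stability (Barbashin-Krasovskii): a `C¹` vector
field with a radially unbounded strict Lyapunov function. -/
theorem globallyAsymptoticallyStable_of_lyapunov {E : Type*} [NormedAddCommGroup E]
    [InnerProductSpace ℝ E] [FiniteDimensional ℝ E] {f : E → E} (hf : ContDiff ℝ 1 f)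
    (hf0 : f 0 = 0) {V : E → ℝ} {V' : E → E →L[ℝ] ℝ} (hV : ∀ x, HasFDerivAt V (V' x) x)
    (hV0 : V 0 = 0) (hVpos : ∀ x, x ≠ 0 → 0 < V x)
    (hVinf : Filter.Tendsto V (Filter.cocompact E) Filter.atTop)
    {l : E → ℝ} (hl : Continuous l) (hlpos : ∀ x, x ≠ 0 → 0 < l x)
    (hdec : ∀ x, V' x (f x) ≤ -l x) : GloballyAsymptoticallyStable f := by
  have : ProperSpace E := FiniteDimensional.proper ℝ E
  have hVc : Continuous V := continuous_iff_continuousAt.2 fun x => (hV x).continuousAt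
  have hdec0 : ∀ x, V' x (f x) ≤ 0 := by
    intro x
    rcases eq_or_ne x 0 with rfl | hx
    · simp [hf0]
    · linarith [hdec x, hlpos x hx]
  have hmono : ∀ φ, IsForwardSolution f φ → ∀ t, 0 ≤ t → V (φ t) ≤ V (φ 0) := by
    intro φ hφ t ht
    simpa using hφ.le_sub_mul hV (c := 0) (fun s _ => by simpa using hdec0 (φ s)) ht
  have hshift : ∀ φ, IsForwardSolution f φ → ∀ s, 0 ≤ s →
      IsForwardSolution f (fun t => φ (t + s)) := by
    intro φ hφ s hs t ht
    have h := (hφ (t + s) (by positivity)).scomp t (h := fun t => t + s) (h' := 1)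
      (s := Set.Ici 0) ((hasDerivAt_id t).add_const s).hasDerivWithinAt
      (fun r hr => add_nonneg hr hs)
    simpa [Function.comp_def] using h
  have hVnn : ∀ x, 0 ≤ V x := fun x => by
    rcases eq_or_ne x 0 with rfl | hx
    · exact hV0.ge
    · exact (hVpos x hx).le
  have hsub : ∀ c, ∃ R, 0 < R ∧ ∀ x, V x ≤ c → ‖x‖ ≤ R := by
    intro c
    obtain ⟨K, hK, hKc⟩ := Filter.mem_cocompact.1 (hVinf.eventually_gt_atTop c)
    obtain ⟨R, hR, hKR⟩ := hK.isBounded.exists_pos_norm_le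
    refine ⟨R, hR, fun x hx => hKR x ?_⟩
    by_contra h
    exact absurd (hKc h) (not_lt.2 hx)
  refine ⟨hf0, fun x₀ => ?_, fun ε hε => ?_, fun φ hφ => ?_⟩
  · obtain ⟨R, hR, hRb⟩ := hsub (V x₀)
    -- The field `χ • f` is bounded and Lipschitz, and still does not increase `V`. Its solution
    -- thus stays in the sublevel set of `x₀`, where `χ = 1`, and so solves the original equation.
    let χ : ContDiffBump (0 : E) := ⟨R, R + 1, hR, by linarith⟩
    have hg : ContDiff ℝ 1 (fun x => χ x • f x) := χ.contDiff.smul hf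
    have hgc : HasCompactSupport (fun x => χ x • f x) := χ.hasCompactSupport.smul_right
    obtain ⟨K, hK⟩ := hg.lipschitzWith_of_hasCompactSupport hgc one_ne_zero
    obtain ⟨C, hC⟩ := hgc.exists_bound_of_continuous hg.continuous
    obtain ⟨φ, hφ0, hφ⟩ := hK.exists_isForwardSolution (C := C.toNNReal)
      (fun x => (hC x).trans (Real.le_coe_toNNReal C)) x₀
    refine ⟨φ, hφ0, fun t ht => ?_⟩
    have hle : V (φ t) ≤ V x₀ := by
      simpa [hφ0] using hφ.le_sub_mul hV (c := 0)
        (fun s _ => by simpa using mul_nonpos_of_nonneg_of_nonpos (χ.nonneg) (hdec0 (φ s))) ht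
    have hone : χ (φ t) = 1 :=
      χ.one_of_mem_closedBall (by simpa using hRb _ hle)
    simpa [hone] using hφ t ht
  · obtain ⟨c, hc, hcε⟩ := exists_pos_forall_lt_imp_norm_lt hVc hVpos hVinf hε
    obtain ⟨δ, hδ, hδc⟩ := Metric.eventually_nhds_iff.1
      (hVc.continuousAt.eventually_lt_const (hV0 ▸ hc : V 0 < c))
    refine ⟨δ, hδ, fun φ hφ h0 t ht => hcε _ ((hmono φ hφ t ht).trans_lt (hδc ?_))⟩
    simpa using h0
  · rw [Metric.tendsto_atTop]
    intro ε hε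
    obtain ⟨c, hc, hcε⟩ := exists_pos_forall_lt_imp_norm_lt hVc hVpos hVinf hε
    obtain ⟨T, hT, hTc⟩ : ∃ T, 0 ≤ T ∧ V (φ T) < c := by
      by_contra! hge
      obtain ⟨R, hR, hRb⟩ := hsub (V (φ 0))
      -- A trajectory with `V ≥ c` forever stays in a compact set avoiding the origin, so `V` falls
      -- at a uniform rate `l z > 0`.
      have hcomp : IsCompact (Metric.closedBall (0 : E) R ∩ {x | c ≤ V x}) :=
        (isCompact_closedBall 0 R).inter_right (isClosed_le continuous_const hVc)
      have hmem : ∀ t, 0 ≤ t → φ t ∈ Metric.closedBall (0 : E) R ∩ {x | c ≤ V x} :=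
        fun t ht => ⟨by simpa using hRb _ (hmono φ hφ t ht), hge t ht⟩
      obtain ⟨z, hz, hmin⟩ := hcomp.exists_isMinOn ⟨_, hmem 0 le_rfl⟩ hl.continuousOn
      have hz0 : z ≠ 0 := by
        rintro rfl
        linarith [show c ≤ V 0 from hz.2]
      have hlz := hlpos z hz0
      -- By this time the rate forces `V ≤ -1`.
      have ht : 0 ≤ (V (φ 0) + 1) / l z := div_nonneg (by linarith [hVnn (φ 0)]) hlz.le
      have h := hφ.le_sub_mul hV (c := l z)
        (fun s hs => (hdec _).trans (neg_le_neg (hmin (hmem s hs)))) ht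
      rw [mul_div_cancel₀ _ hlz.ne'] at h
      linarith [hVnn (φ ((V (φ 0) + 1) / l z))]
    refine ⟨T, fun t ht => ?_⟩
    have h := hmono _ (hshift φ hφ T hT) (t - T) (by linarith)
    simp only [sub_add_cancel, zero_add] at h
    simpa using hcε _ (h.trans_lt hTc)

/-! ### Evaluation and differentiation of polynomials. -/

theorem IsSumSq.eval_nonneg {σ : Type*} {p : MvPolynomial σ ℝ} (hp : IsSumSq p) (x : σ → ℝ) :
    0 ≤ MvPolynomial.eval x p := by
  induction hp with
  | zero => simp
  | sq_add a _ ih =>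
    rw [map_add, map_mul]
    exact add_nonneg (mul_self_nonneg _) ih

theorem IsSOSMatrix.posSemidef_map_eval {n : ℕ} {ι : Type*} [Fintype ι]
    {P : Matrix ι ι (MvPolynomial (Fin n) ℝ)} (hP : IsSOSMatrix P) (x : Fin n → ℝ) :
    (P.map (MvPolynomial.eval x)).PosSemidef := by
  obtain ⟨r, F, rfl⟩ := hP
  have h : (∑ i, (F i).transpose * F i).map (MvPolynomial.eval x) =
      ∑ i, ((F i).map (MvPolynomial.eval x)).conjTranspose * (F i).map (MvPolynomial.eval x) := by
    ext a b
    simp [Matrix.sum_apply, Matrix.mul_apply]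
  rw [h]
  exact Matrix.posSemidef_sum _ fun i _ => Matrix.posSemidef_conjTranspose_mul_self _

section PolynomialCalculus

open MvPolynomial

theorem MvPolynomial.contDiff_eval_euclidean {n : ℕ} (p : MvPolynomial (Fin n) ℝ) :
    ContDiff ℝ 1 fun x : EuclideanSpace ℝ (Fin n) => eval (fun i => x i) p := by
  induction p using MvPolynomial.induction_on with
  | C a => simpa using contDiff_const
  | add p q hp hq => simpa using hp.add hq
  | mul_X p i hp =>
    simp only [map_mul, eval_X]
    exact hp.mul (by fun_prop)

/-- The derivative of a polynomial function on Euclidean space, in terms of `pderiv`. -/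
noncomputable def polyFDeriv {n : ℕ} (p : MvPolynomial (Fin n) ℝ)
    (x : EuclideanSpace ℝ (Fin n)) : EuclideanSpace ℝ (Fin n) →L[ℝ] ℝ :=
  ∑ i, eval (fun j => x j) (pderiv i p) • EuclideanSpace.proj i

theorem hasFDerivAt_eval_polyFDeriv {n : ℕ} (p : MvPolynomial (Fin n) ℝ)
    (x : EuclideanSpace ℝ (Fin n)) :
    HasFDerivAt (fun y : EuclideanSpace ℝ (Fin n) => eval (fun i => y i) p)
      (polyFDeriv p x) x := by
  induction p using MvPolynomial.induction_on with
  | C a => simpa [polyFDeriv] using hasFDerivAt_const a x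
  | add p q hp hq =>
    simp only [map_add]
    refine (hp.add hq).congr_fderiv ?_
    simp [polyFDeriv, add_smul, Finset.sum_add_distrib]
  | mul_X p i hp =>
    have hX : HasFDerivAt (fun y : EuclideanSpace ℝ (Fin n) => y i)
        (EuclideanSpace.proj i : EuclideanSpace ℝ (Fin n) →L[ℝ] ℝ) x :=
      (EuclideanSpace.proj i : EuclideanSpace ℝ (Fin n) →L[ℝ] ℝ).hasFDerivAt
    have h := hp.mul hX
    simp only [map_mul, eval_X]
    refine h.congr_fderiv ?_
    ext v
    simp [polyFDeriv, pderiv_X, Pi.single_apply, add_mul, Finset.sum_add_distrib, apply_ite,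
      Finset.mul_sum, mul_assoc]

end PolynomialCalculus

/-! ### The matrix inequality. -/

-- This is the quadratic form at the test vector `(1, u, v)`.
open scoped Matrix in
theorem Matrix.PosSemidef.quadraticForm_fromBlocks_nonneg {ι κ : Type*} [Fintype ι] [Fintype κ]
    [DecidableEq ι] [DecidableEq κ] {a₀ c d : ℝ} {a : ι → ℝ} {b : κ → ℝ}
    (h : (-(Matrix.fromBlocks
      (Matrix.fromBlocks (Matrix.of fun _ _ => a₀) (Matrix.replicateRow Unit a)
        (Matrix.replicateCol Unit a) (-(c • (1 : Matrix ι ι ℝ))))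
      (Matrix.fromRows (Matrix.replicateRow Unit b) 0)
      (Matrix.fromCols (Matrix.replicateCol Unit b) 0)
      (-(d • (1 : Matrix κ κ ℝ))))).PosSemidef) (u : ι → ℝ) (v : κ → ℝ) :
    0 ≤ -a₀ - 2 * (a ⬝ᵥ u) - 2 * (b ⬝ᵥ v) + c * (u ⬝ᵥ u) + d * (v ⬝ᵥ v) := by
  have h1 := h.dotProduct_mulVec_nonneg (Sum.elim (Sum.elim (fun _ => 1) u) v)
  have e1 : Matrix.replicateRow Unit a *ᵥ u = fun _ => a ⬝ᵥ u := rfl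
  have e2 : Matrix.replicateRow Unit b *ᵥ v = fun _ => b ⬝ᵥ v := rfl
  have e3 : Matrix.replicateCol Unit a *ᵥ (fun _ => (1 : ℝ)) = a := by
    ext i; simp [Matrix.mulVec, dotProduct]
  have e4 : Matrix.replicateCol Unit b *ᵥ (fun _ => (1 : ℝ)) = b := by
    ext i; simp [Matrix.mulVec, dotProduct]
  have e5 : (Matrix.of fun (_ _ : Unit) => a₀) *ᵥ (fun _ => (1 : ℝ)) = fun _ => a₀ := by
    ext i; simp [Matrix.mulVec, dotProduct]
  have e6 : ∀ s t : Unit → ℝ, s ⬝ᵥ t = s () * t () := fun s t => by simp [dotProduct]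
  simp only [star_trivial, Matrix.neg_mulVec, Matrix.fromBlocks_mulVec, Sum.elim_comp_inl,
    Sum.elim_comp_inr, Matrix.fromRows_mulVec, Matrix.fromCols_mulVec, e1, e2, e3, e4, e5,
    Matrix.smul_mulVec, Matrix.one_mulVec, Matrix.zero_mulVec, dotProduct_neg,
    sumElim_dotProduct_sumElim, dotProduct_add, dotProduct_smul, smul_eq_mul,
    add_zero] at h1
  simp only [e6, dotProduct_comm u a, dotProduct_comm v b, dotProduct_zero] at h1
  linarith

open scoped Matrix in
/-- The non-strict Petersen bound on the uncertain term of the Lyapunov derivative. -/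
theorem dotProduct_le_of_posSemidef_fromBlocks {ι κ : Type*} [Fintype ι] [Fintype κ]
    [DecidableEq ι] [DecidableEq κ] {bA : Matrix ι ι ℝ} (hA : bA.PosDef)
    {bQ : Matrix κ κ ℝ} (hQ : bQ.PosSemidef) {D : Matrix ι κ ℝ}
    (hD : (bQ - Dᵀ * bA * D).PosSemidef) {a₀ c : ℝ} (hc : 0 ≤ c) {q : ι → ℝ} {g : κ → ℝ}
    (h : (-(Matrix.fromBlocks
      (Matrix.fromBlocks (Matrix.of fun _ _ => a₀)
        (Matrix.replicateRow Unit ((psdSqrt bA)⁻¹ *ᵥ q))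
        (Matrix.replicateCol Unit ((psdSqrt bA)⁻¹ *ᵥ q)) (-(c • (1 : Matrix ι ι ℝ))))
      (Matrix.fromRows (Matrix.replicateRow Unit (c • (psdSqrt bQ *ᵥ g))) 0)
      (Matrix.fromCols (Matrix.replicateCol Unit (c • (psdSqrt bQ *ᵥ g))) 0)
      (-((4 * c) • (1 : Matrix κ κ ℝ))))).PosSemidef) :
    a₀ + g ⬝ᵥ (Dᵀ *ᵥ q) ≤ 0 := by
  obtain ⟨hR, hRR⟩ := (psdSqrt_eq_iff hA.posSemidef).1 rfl
  obtain ⟨hS, hSS⟩ := (psdSqrt_eq_iff hQ).1 rfl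
  set R := psdSqrt bA
  set S := psdSqrt bQ
  have hRt : Rᵀ = R := by simpa using hR.isHermitian.eq
  have hSt : Sᵀ = S := by simpa using hS.isHermitian.eq
  have hRu : IsUnit R.det := by
    have := hA.isUnit
    rw [← hRR, Matrix.isUnit_iff_isUnit_det, Matrix.det_mul] at this
    exact isUnit_of_mul_isUnit_left this
  have hcross : (R⁻¹ *ᵥ q) ⬝ᵥ (R *ᵥ (D *ᵥ g)) = g ⬝ᵥ (Dᵀ *ᵥ q) := by
    rw [Matrix.dotProduct_mulVec, ← Matrix.mulVec_transpose, hRt, Matrix.mulVec_mulVec,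
      Matrix.mul_nonsing_inv _ hRu, Matrix.one_mulVec, Matrix.dotProduct_mulVec,
      ← Matrix.mulVec_transpose, dotProduct_comm]
  have hle : (R *ᵥ (D *ᵥ g)) ⬝ᵥ (R *ᵥ (D *ᵥ g)) ≤ (S *ᵥ g) ⬝ᵥ (S *ᵥ g) := by
    have h1 := hD.dotProduct_mulVec_nonneg g
    have h2 : (R *ᵥ (D *ᵥ g)) ⬝ᵥ (R *ᵥ (D *ᵥ g)) = g ⬝ᵥ ((Dᵀ * bA * D) *ᵥ g) := by
      rw [Matrix.mulVec_mulVec, Matrix.dotProduct_mulVec, ← Matrix.mulVec_transpose,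
        dotProduct_comm, Matrix.mulVec_mulVec, Matrix.transpose_mul, hRt, ← hRR]
      simp only [Matrix.mul_assoc]
    have h3 : (S *ᵥ g) ⬝ᵥ (S *ᵥ g) = g ⬝ᵥ (bQ *ᵥ g) := by
      rw [← hSS, Matrix.dotProduct_mulVec, ← Matrix.mulVec_transpose, hSt, dotProduct_comm,
        Matrix.mulVec_mulVec]
    simp only [star_trivial, Matrix.sub_mulVec, dotProduct_sub] at h1
    linarith
  -- The factor `1/2` reproduces the cross term `g ⬝ Dᵀ q` exactly; `1/4` minimizes the form in `v`.
  -- What remains is `a₀ + g ⬝ Dᵀ q ≤ (c/4) (|R D g|² - |S g|²)`, nonpositive by `hle`; no division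
  -- by `c` is needed.
  have key := h.quadraticForm_fromBlocks_nonneg ((2⁻¹ : ℝ) • (R *ᵥ (D *ᵥ g)))
    ((4⁻¹ : ℝ) • (S *ᵥ g))
  simp only [dotProduct_smul, smul_dotProduct, smul_eq_mul, hcross] at key
  nlinarith [mul_le_mul_of_nonneg_left hle hc]

/-! ### Application to the closed loop. -/

open scoped Matrix in
theorem decreaseMatrix_map_eval {n m N M : ℕ} (Z : Fin N → MvPolynomial (Fin n) ℝ)
    (W : Matrix (Fin M) (Fin m) (MvPolynomial (Fin n) ℝ))
    (bA : Matrix (Fin N ⊕ Fin M) (Fin N ⊕ Fin M) ℝ)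
    (Zc : Matrix (Fin N ⊕ Fin M) (Fin n) ℝ) (bQ : Matrix (Fin n) (Fin n) ℝ)
    (l₂ V lam : MvPolynomial (Fin n) ℝ) (k : Fin m → MvPolynomial (Fin n) ℝ) (x : Fin n → ℝ) :
    (decreaseMatrix Z W bA Zc bQ l₂ V lam k).map (MvPolynomial.eval x) =
      let q := fun i => MvPolynomial.eval x (stackedRegressor Z W k i)
      let g := fun i => MvPolynomial.eval x (polyGrad V i)
      let c := MvPolynomial.eval x lam
      Matrix.fromBlocks
        (Matrix.fromBlocks
          (Matrix.of fun _ _ => MvPolynomial.eval x l₂ + g ⬝ᵥ (Zcᵀ *ᵥ q))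
          (Matrix.replicateRow Unit ((psdSqrt bA)⁻¹ *ᵥ q))
          (Matrix.replicateCol Unit ((psdSqrt bA)⁻¹ *ᵥ q))
          (-(c • (1 : Matrix (Fin N ⊕ Fin M) (Fin N ⊕ Fin M) ℝ))))
        (Matrix.fromRows (Matrix.replicateRow Unit (c • (psdSqrt bQ *ᵥ g))) 0)
        (Matrix.fromCols (Matrix.replicateCol Unit (c • (psdSqrt bQ *ᵥ g))) 0)
        (-((4 * c) • (1 : Matrix (Fin n) (Fin n) ℝ))) := by
  ext ((i | i) | i) ((j | j) | j) <;>
    simp [decreaseMatrix, Matrix.mulVec, dotProduct, Matrix.one_apply] <;> split_ifs <;> simp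

open scoped Matrix in
theorem closedLoop_eq {n m N M : ℕ} (Z : Fin N → MvPolynomial (Fin n) ℝ)
    (W : Matrix (Fin M) (Fin m) (MvPolynomial (Fin n) ℝ)) (k : Fin m → MvPolynomial (Fin n) ℝ)
    (A : Matrix (Fin n) (Fin N) ℝ) (B : Matrix (Fin n) (Fin M) ℝ)
    (x : EuclideanSpace ℝ (Fin n)) :
    closedLoop Z W k A B x = WithLp.toLp 2 (Matrix.fromCols A B *ᵥ
      fun i => MvPolynomial.eval (fun j => x j) (stackedRegressor Z W k i)) := by
  rw [Matrix.fromCols_mulVec]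
  simp only [closedLoop, stackedRegressor]
  congr 3
  ext i
  simp [Matrix.mulVec, dotProduct]

theorem contDiff_closedLoop {n m N M : ℕ} (Z : Fin N → MvPolynomial (Fin n) ℝ)
    (W : Matrix (Fin M) (Fin m) (MvPolynomial (Fin n) ℝ)) (k : Fin m → MvPolynomial (Fin n) ℝ)
    (A : Matrix (Fin n) (Fin N) ℝ) (B : Matrix (Fin n) (Fin M) ℝ) :
    ContDiff ℝ 1 (closedLoop Z W k A B) := by
  rw [contDiff_euclidean]
  intro i
  simp only [closedLoop_eq, Matrix.mulVec, dotProduct]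
  exact ContDiff.sum fun j _ =>
    contDiff_const.mul (MvPolynomial.contDiff_eval_euclidean _)

theorem corollary2 {n m N M : ℕ}
    (Z : Fin N → MvPolynomial (Fin n) ℝ)
    (W : Matrix (Fin M) (Fin m) (MvPolynomial (Fin n) ℝ))
    (hZ : ∀ i, MvPolynomial.eval 0 (Z i) = 0)
    (bA : Matrix (Fin N ⊕ Fin M) (Fin N ⊕ Fin M) ℝ)
    (Zc : Matrix (Fin N ⊕ Fin M) (Fin n) ℝ)
    (bQ : Matrix (Fin n) (Fin n) ℝ)
    (hA : bA.PosDef) (hQ : bQ.PosSemidef)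
    (l₁ l₂ : MvPolynomial (Fin n) ℝ)
    (hl₁ : PolyPosDef l₁) (hl₂ : PolyPosDef l₂) (hl₁_unbdd : RadiallyUnbounded l₁)
    (εlam : ℝ) (hεlam : 0 < εlam)
    (V lam : MvPolynomial (Fin n) ℝ) (k : Fin m → MvPolynomial (Fin n) ℝ)
    (hV : MvPolynomial.eval 0 V = 0) (hk : ∀ i, MvPolynomial.eval 0 (k i) = 0)
    (hsos_V : IsSumSq (V - l₁))
    (hsos_decrease : IsSOSMatrix (-(decreaseMatrix Z W bA Zc bQ l₂ V lam k)))
    (hsos_lam : IsSumSq (lam - MvPolynomial.C εlam)) :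
    (∀ x : Fin n → ℝ,
      0 ≤ MvPolynomial.eval x V - MvPolynomial.eval x l₁ ∧
      (-((decreaseMatrix Z W bA Zc bQ l₂ V lam k).map (MvPolynomial.eval x))).PosSemidef ∧
      0 < MvPolynomial.eval x lam) ∧
    ∀ A : Matrix (Fin n) (Fin N) ℝ, ∀ B : Matrix (Fin n) (Fin M) ℝ,
      (A, B) ∈ matrixEllipsoid bA Zc bQ →
        GloballyAsymptoticallyStable (closedLoop Z W k A B) := by
  have hpt : ∀ x : Fin n → ℝ,
      0 ≤ MvPolynomial.eval x V - MvPolynomial.eval x l₁ ∧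
      (-((decreaseMatrix Z W bA Zc bQ l₂ V lam k).map (MvPolynomial.eval x))).PosSemidef ∧
      0 < MvPolynomial.eval x lam := by
    intro x
    refine ⟨by simpa using hsos_V.eval_nonneg x, ?_, ?_⟩
    · have h := hsos_decrease.posSemidef_map_eval x
      rwa [Matrix.map_neg _ (map_neg _)] at h
    · have h := hsos_lam.eval_nonneg x
      rw [map_sub, MvPolynomial.eval_C] at h
      linarith
  refine ⟨hpt, ?_⟩
  rintro A B ⟨Y, hY, hD⟩
  have hne : ∀ x : EuclideanSpace ℝ (Fin n), x ≠ 0 → (fun i => x i) ≠ 0 := by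
    intro x hx h0
    exact hx (by ext i; exact congrFun h0 i)
  have hzero : (fun i => (0 : EuclideanSpace ℝ (Fin n)) i) = 0 := rfl
  refine globallyAsymptoticallyStable_of_lyapunov (contDiff_closedLoop Z W k A B) ?_
    (hasFDerivAt_eval_polyFDeriv V) hV (fun x hx => ?_) ?_
    (MvPolynomial.contDiff_eval_euclidean l₂).continuous
    (fun x hx => hl₂.2 _ (hne x hx)) (fun x => ?_)
  · simp only [closedLoop, hzero, hZ, hk]
    ext i
    simp [Matrix.mulVec, dotProduct]
  · linarith [(hpt fun i => x i).1, hl₁.2 _ (hne x hx)]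
  · rw [← Metric.cobounded_eq_cocompact, ← comap_norm_atTop]
    exact Filter.tendsto_atTop_mono (fun x => sub_nonneg.1 (hpt fun i => x i).1) hl₁_unbdd
  · obtain ⟨-, hΨ, hlam⟩ := hpt fun i => x i
    rw [decreaseMatrix_map_eval] at hΨ
    have h := dotProduct_le_of_posSemidef_fromBlocks hA hQ hD hlam.le hΨ
    -- The `Zc` part of `D = Y - Zc` cancels the nominal term in the corner of `Ψ`.
    rw [Matrix.transpose_sub, Matrix.sub_mulVec, dotProduct_sub] at h
    have hder : polyFDeriv V x (closedLoop Z W k A B x) =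
        (fun i => MvPolynomial.eval (fun j => x j) (polyGrad V i)) ⬝ᵥ (Y.transpose.mulVec
          fun i => MvPolynomial.eval (fun j => x j) (stackedRegressor Z W k i)) := by
      rw [closedLoop_eq, hY]
      simp [polyFDeriv, polyGrad, dotProduct]
    rw [hder]
    linarith
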